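/- All groups and graphs are finite and all graphs are simple. For a group $G$, the prime graph $\Gamma_G$ has as vertices the primes dividing $|G|$, and two distinct primes $p,q$ are adjacent if and only if $G$ has an element of order $pq$. (i) Let $G$ be a nontrivial finite solvable group. Then $\Gamma_G$ has girth $3$, except exactly when $\Gamma_G$ is (isomorphic to) the $4$-cycle, the $5$-cycle, or a forest with at least one vertex that contains no independent set of size $3$. (ii) Each of these exceptions occurs: every graph that is a $4$-cycle, a $5$-cycle, or a forest with at least one vertex and no independent set of size $3$ is isomorphic to the prime graph of some nontrivial finite solvable group. (iii) Up to isomorphism there are exactly $7$ forests with at least one vertex and no independent set of size $3$, namely: a single vertex, two isolated vertices, a single edge, the disjoint union of an edge and an isolated vertex, the path on $3$ vertices, the disjoint union of two edges, and the path on $4$ vertices. That is, these seven are pairwise non-isomorphic, and a graph is a forest with at least one vertex and no independent set of size $3$ if and only if it is isomorphic to one of them. -/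

import Mathlib

/-- The prime graph (Gruenberg-Kegel graph) of a finite group `G`: the vertices are the primes
dividing `|G|`, and two distinct primes `p`, `q` are adjacent iff `G` has an element of order
`p * q`. -/
def primeGraph (G : Type*) [Group G] : SimpleGraph {p : ℕ // p.Prime ∧ p ∣ Nat.card G} where
  Adj p q := p ≠ q ∧ ∃ g : G, orderOf g = (p : ℕ) * (q : ℕ)
  symm := ⟨fun _ _ h => ⟨h.1.symm, h.2.imp fun _ hg => hg.trans (Nat.mul_comm _ _)⟩⟩
  loopless := ⟨fun _ h => h.1 rfl⟩

/-- A forest with at least one vertex and without an independent set of size `3`. -/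
def IsExceptionalForest {V : Type*} (F : SimpleGraph V) : Prop :=
  Nonempty V ∧ F.IsAcyclic ∧ F.IndepSetFree 3

/-- The exceptional graphs: the `4`-cycle, the `5`-cycle, and the exceptional forests. -/
def IsExceptionalGraph {V : Type*} (F : SimpleGraph V) : Prop :=
  Nonempty (F ≃g SimpleGraph.cycleGraph 4) ∨ Nonempty (F ≃g SimpleGraph.cycleGraph 5) ∨
    IsExceptionalForest F

/-- The explicit list of seven forests: a single vertex, two isolated vertices, a single edge,
an edge and an isolated vertex, the path on three vertices, two disjoint edges, and the path on
four vertices. -/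
def sevenForests : Fin 7 → (n : ℕ) × SimpleGraph (Fin n) :=
  ![⟨1, ⊥⟩,
    ⟨2, ⊥⟩,
    ⟨2, SimpleGraph.fromEdgeSet {s(0, 1)}⟩,
    ⟨3, SimpleGraph.fromEdgeSet {s(0, 1)}⟩,
    ⟨3, SimpleGraph.fromEdgeSet {s(0, 1), s(1, 2)}⟩,
    ⟨4, SimpleGraph.fromEdgeSet {s(0, 1), s(2, 3)}⟩,
    ⟨4, SimpleGraph.fromEdgeSet {s(0, 1), s(1, 2), s(2, 3)}⟩]

/-!
The group theory enters through Lucido's three primes lemma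
(`exists_orderOf_eq_mul_of_three_primes`): the prime graph of a finite solvable group has no
independent set of size `3`. If it has no triangle either, then `R(3, 3) = 6` bounds the number of
vertices by `5`, and a finite check leaves seven forests, the `4`-cycle and the `5`-cycle
(`SimpleGraph.nonempty_iso_of_cliqueFree_of_indepSetFree`). Girth `3` means that there is a
triangle, so the dichotomy and the list of forests both come out of this classification.

For the three primes lemma, induction on the group order reduces to a group `G` with a normal
elementary abelian `p`-subgroup `N` such that `q` and `r` divide `|G / N|`. Hall subgroups are
avoided: a Frattini argument gives, up to interchanging `q` and `r`, a nontrivial `q`-subgroup `Q`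
of `G / N` normalised by an element of order `r` (`hasActingPair_or`), generating `R` say. Without
elements of order `p * q`, `p * r` or `q * r`, the product `Q R` is a Frobenius group, and neither `Q` nor `R`
has a nontrivial fixed point on `N`. Averaging over the conjugates of `R` shows that `|Q|`
annihilates `N` (`pow_card_eq_one_of_forall_fixed`), which is absurd.

All nine graphs are realised by semidirect products `A ⋊ H` of coprime orders with `A` abelian.
There the orders `p * q` are governed by pairs `(a, h)` with `h` fixing `a`
(`SemidirectProduct.exists_orderOf_eq_mul_iff`). All but the `5`-cycle come from `ℤ/n ⋊ ℤ/m`; the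
`5`-cycle comes from `(𝔽₃₁² × 𝔽₁₁) ⋊ (D₃ × ℤ/5)`.
-/

/-! ### Three primes dividing the order of a solvable group -/

/-- Orders of elements of a homomorphic image are orders of elements of the group. -/
theorem exists_orderOf_eq_of_map {G K : Type*} [Group G] [Group K] [Finite G] (f : G →* K)
    (g : G) : ∃ h : G, orderOf h = orderOf (f g) := by
  refine ⟨g ^ (orderOf g / orderOf (f g)), ?_⟩
  have hd := orderOf_map_dvd f g
  have h0 := (orderOf_pos g).ne'
  rw [orderOf_pow_of_dvd (Nat.div_pos (Nat.le_of_dvd (orderOf_pos g) hd)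
    (Nat.pos_of_dvd_of_pos hd (orderOf_pos g))).ne' (Nat.div_dvd_of_dvd hd), Nat.div_div_self hd h0]

theorem Commute.exists_orderOf_eq_mul {G : Type*} [Group G] [Finite G] {x y : G}
    (hxy : Commute x y) {p q : ℕ} (hp : p.Prime) (hq : q.Prime) (hpq : p ≠ q)
    (hx : p ∣ orderOf x) (hy : q ∣ orderOf y) : ∃ g : G, orderOf g = p * q := by
  have aux : ∀ (z : G) (n : ℕ), n ≠ 0 → n ∣ orderOf z → orderOf (z ^ (orderOf z / n)) = n := by
    intro z n hn hd
    rw [orderOf_pow_of_dvd (Nat.div_pos (Nat.le_of_dvd (orderOf_pos z) hd)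
      (Nat.pos_of_ne_zero hn)).ne' (Nat.div_dvd_of_dvd hd), Nat.div_div_self hd (orderOf_pos z).ne']
  have h1 := aux x p hp.ne_zero hx
  have h2 := aux y q hq.ne_zero hy
  refine ⟨x ^ (orderOf x / p) * y ^ (orderOf y / q), ?_⟩
  rw [(hxy.pow_pow _ _).orderOf_mul_eq_mul_orderOf_of_coprime, h1, h2]
  rw [h1, h2]
  exact (Nat.coprime_primes hp hq).2 hpq

/-- If `R` normalises `Q` and acts on it without fixed points (so that `Q R` is a Frobenius group),
and neither `Q` nor `R` has a nontrivial fixed point on the abelian group `V`, then `V` has exponent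
dividing `|Q|`. The proof evaluates the product of `x g x⁻¹ • v` over `x ∈ Q` and `g ∈ R` twice:
multiplying over `g` first gives `1`, and multiplying over `x` first leaves only the term
`g = 1`. -/
theorem pow_card_eq_one_of_forall_fixed {K V : Type*} [Group K] [Finite K] [CommGroup V]
    (φ : K →* MulAut V) (Q R : Subgroup K)
    (hR : ∀ g ∈ R, ∀ x ∈ Q, g * x * g⁻¹ ∈ Q)
    (hQR : ∀ g ∈ R, g ≠ 1 → ∀ x ∈ Q, Commute g x → x = 1)
    (hfixQ : ∀ v, (∀ x ∈ Q, φ x v = v) → v = 1)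
    (hfixR : ∀ v, (∀ g ∈ R, φ g v = v) → v = 1)
    (v : V) : v ^ Nat.card Q = 1 := by
  classical
  have := Fintype.ofFinite K
  have prodFixed : ∀ (S : Subgroup K) (w : V), ∀ s ∈ S, φ s (∏ x : S, φ x w) = ∏ x : S, φ x w := by
    intro S w s hs
    rw [map_prod]
    refine Fintype.prod_equiv (Equiv.mulLeft (⟨s, hs⟩ : S)) _ _ fun x => ?_
    simp
  have hQ1 : ∀ w : V, ∏ x : Q, φ x w = 1 := fun w => hfixQ _ (prodFixed Q w)
  have hR1 : ∀ w : V, ∏ x : R, φ x w = 1 := fun w => hfixR _ (prodFixed R w)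
  have key : ∏ x : Q, ∏ g : R, φ (x * g * (x : K)⁻¹) v = 1 := by
    refine Finset.prod_eq_one fun x _ => ?_
    have : ∀ g : R, φ (x * g * (x : K)⁻¹) v = φ x (φ g (φ (x : K)⁻¹ v)) := by
      intro g; simp
    simp_rw [this, ← map_prod, hR1, map_one]
  rw [Finset.prod_comm, Fintype.prod_eq_single (1 : R)] at key
  · simpa [Nat.card_eq_fintype_card] using key
  · intro g hg
    have hg' : (g : K) ≠ 1 := fun h => hg (Subtype.ext h)
    -- conjugates of `g` under `Q` fill the coset `Q g`: `x g x⁻¹ = f x * g` with `f` a bijection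
    let f : Q → Q := fun x => ⟨x * (g * (x : K)⁻¹ * (g : K)⁻¹),
      Q.mul_mem x.2 (hR g g.2 _ (Q.inv_mem x.2))⟩
    have hf : Function.Injective f := by
      intro x y hxy
      have h : (x : K) * (g * (x : K)⁻¹ * (g : K)⁻¹) = y * (g * (y : K)⁻¹ * (g : K)⁻¹) :=
        congrArg Subtype.val hxy
      have h2 : (y : K)⁻¹ * x = 1 := by
        refine hQR g g.2 hg' _ (Q.mul_mem (Q.inv_mem y.2) x.2) ?_
        have h3 : (x : K) * g * (x : K)⁻¹ = y * g * (y : K)⁻¹ := by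
          have h5 := congrArg (· * (g : K)) h
          simpa [mul_assoc] using h5
        have h4 : (x : K) * g = y * g * (y : K)⁻¹ * x := by rw [← h3]; group
        show (g : K) * ((y : K)⁻¹ * x) = (y : K)⁻¹ * x * g
        rw [mul_assoc (y : K)⁻¹, h4]; group
      exact (Subtype.ext (inv_mul_eq_one.1 h2)).symm
    rw [← hQ1 (φ g v)]
    refine Fintype.prod_bijective f (Finite.injective_iff_bijective.1 hf) _ _ fun x => ?_
    simp [f, mul_assoc]

/-- The group `K` has a nontrivial `q`-subgroup normalised by an element of order `r`. Only
conjugation by `g` into `Q` is asked for; in a finite group this says that `g` normalises `Q`. -/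
def HasActingPair (K : Type*) [Group K] (q r : ℕ) : Prop :=
  ∃ (Q : Subgroup K) (g : K), IsPGroup q Q ∧ Q ≠ ⊥ ∧ orderOf g = r ∧ ∀ x ∈ Q, g * x * g⁻¹ ∈ Q

theorem HasActingPair.of_injective {K L : Type*} [Group K] [Group L] {q r : ℕ} (f : K →* L)
    (hf : Function.Injective f) (h : HasActingPair K q r) : HasActingPair L q r := by
  obtain ⟨Q, g, hQ, hQ1, hg, hn⟩ := h
  refine ⟨Q.map f, f g, hQ.map f, ?_, (orderOf_injective f hf g).trans hg, ?_⟩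
  · rwa [Ne, Subgroup.map_eq_bot_iff_of_injective _ hf]
  · rintro _ ⟨x, hx, rfl⟩
    exact ⟨_, hn x hx, by simp⟩

/-- By the Frattini argument a Sylow `q`-subgroup of `L` has a normaliser that covers `G ⧸ L`, and
so contains elements of order `r`. -/
theorem hasActingPair_of_normal {G : Type*} [Group G] [Finite G] {q r : ℕ} [Fact q.Prime]
    [Fact r.Prime] (L : Subgroup G) [L.Normal] (hq : q ∣ Nat.card L) (hr : ¬ r ∣ Nat.card L)
    (hrG : r ∣ Nat.card G) : HasActingPair G q r := by
  let P : Sylow q L := default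
  let Q : Subgroup G := (P : Subgroup L).map L.subtype
  have h1 : Subgroup.normalizer (Q : Set G) ⊔ L = ⊤ := P.normalizer_sup_eq_top
  have h2 : r ∣ Nat.card (Subgroup.normalizer (Q : Set G)) := by
    have h3 : Nat.card G ∣ Nat.card (Subgroup.normalizer (Q : Set G)) * Nat.card L := by
      have := Subgroup.card_mul_index L
      have h5 := Subgroup.relIndex_dvd_card L (Subgroup.normalizer (Q : Set G))
      have h4 : L.relIndex (Subgroup.normalizer (Q : Set G)) = L.index := by
        rw [← Subgroup.relIndex_sup_right, h1, Subgroup.relIndex_top_right]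
      rw [h4] at h5
      rw [← this, mul_comm]
      exact mul_dvd_mul_right h5 _
    exact ((Fact.out : r.Prime).dvd_mul.1 (hrG.trans h3)).resolve_right hr
  obtain ⟨g, hg⟩ := exists_prime_orderOf_dvd_card' r h2
  refine ⟨Q, g, P.isPGroup'.map _, ?_, by simpa using hg, fun x hx => ?_⟩
  · rw [Ne, Subgroup.map_eq_bot_iff_of_injective _ L.subtype_injective]
    exact P.ne_bot_of_dvd_card hq
  · exact (Subgroup.mem_normalizer_iff.1 g.2 x).1 hx

/-- Acting pairs lift through a quotient by a normal subgroup of order prime to `r`: the Frattini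
argument applies to the preimage of `Q` inside its normaliser. -/
theorem HasActingPair.of_quotient {K : Type*} [Group K] [Finite K] {q r : ℕ} [Fact q.Prime]
    [Fact r.Prime] (hqr : q ≠ r) (M : Subgroup K) [M.Normal] (hM : ¬ r ∣ Nat.card M)
    (h : HasActingPair (K ⧸ M) q r) : HasActingPair K q r := by
  obtain ⟨Q, g, hQ, hQ1, hg, hn⟩ := h
  obtain ⟨g, rfl⟩ := QuotientGroup.mk'_surjective M g
  let L := Q.comap (QuotientGroup.mk' M)
  have hmemL : ∀ x, x ∈ L ↔ QuotientGroup.mk' M x ∈ Q := fun x => Iff.rfl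
  let N := Subgroup.normalizer (L : Set K)
  have hgN : g ∈ N := by
    have : ∀ x ∈ L, g * x * g⁻¹ ∈ L := fun x hx => by
      simpa [L] using hn _ hx
    exact Subgroup.mem_normalizer_fintype this
  refine HasActingPair.of_injective N.subtype N.subtype_injective
    (hasActingPair_of_normal (L.subgroupOf N) ?_ ?_ ?_)
  · rw [Nat.card_congr (Subgroup.subgroupOfEquivOfLe (Subgroup.le_normalizer)).toEquiv]
    obtain ⟨⟨y, hy⟩, hy1⟩ := Subgroup.ne_bot_iff_exists_ne_one.1 hQ1
    obtain ⟨x, rfl⟩ := QuotientGroup.mk'_surjective M y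
    have h1 : q ∣ orderOf (QuotientGroup.mk' M x) := by
      rw [← Q.orderOf_mk _ hy]
      exact hQ.dvd_orderOf hy1
    exact (h1.trans (orderOf_map_dvd _ x)).trans
      (Subgroup.orderOf_dvd_natCard L (x := x) ((hmemL x).2 hy))
  · rw [Nat.card_congr (Subgroup.subgroupOfEquivOfLe (Subgroup.le_normalizer)).toEquiv]
    intro hr
    obtain ⟨⟨x, hx⟩, hxr⟩ := exists_prime_orderOf_dvd_card' r hr
    rw [Subgroup.orderOf_mk] at hxr
    have h1 : orderOf (QuotientGroup.mk' M x) = 1 := by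
      obtain ⟨k, hk⟩ := (IsPGroup.iff_orderOf.1 hQ) ⟨_, (hmemL x).1 hx⟩
      rw [Subgroup.orderOf_mk] at hk
      have h3 := orderOf_map_dvd (QuotientGroup.mk' M) x
      rw [hxr] at h3
      refine Nat.eq_one_of_dvd_coprimes ?_ hk.dvd h3
      exact Nat.Coprime.pow_left k ((Nat.coprime_primes Fact.out Fact.out).2 hqr)
    have h2 : x ∈ M := by simpa using h1
    apply hM
    rw [← hxr]
    exact Subgroup.orderOf_dvd_natCard M h2
  · rw [← hg]
    exact (orderOf_map_dvd _ g).trans (Subgroup.orderOf_dvd_natCard N hgN)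

open scoped commutatorElement in
/-- A nontrivial finite solvable group has a nontrivial normal elementary abelian `p`-subgroup: the
elements `a` with `a ^ p = 1` in the last nontrivial term of the derived series. -/
theorem exists_normal_exponent_prime (G : Type*) [Group G] [Finite G] [Nontrivial G]
    (hG : Group.IsSolvable G) :
    ∃ (p : ℕ) (N : Subgroup G), p.Prime ∧ N.Normal ∧ N ≠ ⊥ ∧ (∀ a ∈ N, ∀ b ∈ N, a * b = b * a) ∧
      ∀ a ∈ N, a ^ p = 1 := by
  classical
  have hex := hG.solvable
  obtain ⟨A, hA, hA1, hAc⟩ : ∃ A : Subgroup G, A.Normal ∧ A ≠ ⊥ ∧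
      ∀ a ∈ A, ∀ b ∈ A, a * b = b * a := by
    obtain ⟨k, hk⟩ : ∃ k, Nat.find hex = k + 1 := by
      refine Nat.exists_eq_succ_of_ne_zero fun h0 => ?_
      have := Nat.find_spec hex
      rw [h0, derivedSeries_zero] at this
      exact top_ne_bot this
    refine ⟨derivedSeries G k, derivedSeries_normal G k, Nat.find_min hex (by omega), ?_⟩
    intro a ha b hb
    have h1 : ⁅a, b⁆ ∈ derivedSeries G (k + 1) := by
      rw [derivedSeries_succ]; exact Subgroup.commutator_mem_commutator ha hb
    rw [← hk, Nat.find_spec hex, Subgroup.mem_bot, commutatorElement_eq_one_iff_mul_comm] at h1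
    exact h1
  obtain ⟨a, ha1⟩ := Subgroup.ne_bot_iff_exists_ne_one.1 hA1
  have hcard : Nat.card A ≠ 1 := fun h => hA1 (Subgroup.card_eq_one.1 h)
  obtain ⟨p, hp, hpA⟩ := Nat.exists_prime_and_dvd hcard
  have := Fact.mk hp
  obtain ⟨z, hz⟩ := exists_prime_orderOf_dvd_card' p hpA
  let N : Subgroup G :=
    { carrier := {a | a ∈ A ∧ a ^ p = 1}
      mul_mem' := fun {a b} ha hb => ⟨A.mul_mem ha.1 hb.1, by
        rw [Commute.mul_pow (hAc a ha.1 b hb.1), ha.2, hb.2, one_mul]⟩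
      one_mem' := ⟨A.one_mem, one_pow p⟩
      inv_mem' := fun {a} ha => ⟨A.inv_mem ha.1, by rw [inv_pow, ha.2, inv_one]⟩ }
  refine ⟨p, N, hp, ⟨fun n hn g => ⟨hA.conj_mem n hn.1 g, ?_⟩⟩, ?_,
    fun a ha b hb => hAc a ha.1 b hb.1, fun a ha => ha.2⟩
  · rw [conj_pow, hn.2]; simp
  · intro h
    have hzN : (z : G) ∈ N := ⟨z.2, by
      rw [← Subgroup.coe_pow, ← hz, pow_orderOf_eq_one, Subgroup.coe_one]⟩
    rw [h, Subgroup.mem_bot] at hzN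
    rw [← Subgroup.orderOf_coe, hzN, orderOf_one] at hz
    exact hp.one_lt.ne hz

theorem IsPGroup.of_forall_pow_eq_one {G : Type*} [Group G] {p : ℕ} (h : ∀ a : G, a ^ p = 1) :
    IsPGroup p G := fun a => ⟨1, by rw [pow_one, h]⟩

theorem eq_of_dvd_card_of_exponent {G : Type*} [Group G] [Finite G] {p r : ℕ} (N : Subgroup G)
    (hp : p.Prime) (hr : r.Prime) (hN : ∀ a ∈ N, a ^ p = 1) (h : r ∣ Nat.card N) : r = p := by
  have := Fact.mk hr
  obtain ⟨z, hz⟩ := exists_prime_orderOf_dvd_card' r h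
  have h1 : orderOf z ∣ p := orderOf_dvd_of_pow_eq_one (Subtype.ext (hN z z.2))
  rw [hz] at h1
  exact (Nat.prime_dvd_prime_iff_eq hr hp).1 h1

/-- A substitute for a Hall `{q, r}`-subgroup: a solvable group whose order is divisible by `q` and
`r` has a `q`-subgroup normalised by an element of order `r`, or the other way round. -/
theorem hasActingPair_or {q r : ℕ} [Fact q.Prime] [Fact r.Prime] (hqr : q ≠ r) (n : ℕ) :
    ∀ (K : Type*) [Group K] [Finite K], Group.IsSolvable K → Nat.card K = n →
      q ∣ Nat.card K → r ∣ Nat.card K → HasActingPair K q r ∨ HasActingPair K r q := by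
  induction n using Nat.strong_induction_on with
  | _ n ih =>
  intro K _ _ hK hn hq hr
  have : Nontrivial K := by
    rw [← Finite.one_lt_card_iff_nontrivial]
    exact (Fact.out : q.Prime).one_lt.trans_le (Nat.le_of_dvd Nat.card_pos hq)
  obtain ⟨t, M, ht, hMn, hM1, -, hMt⟩ := exists_normal_exponent_prime K hK
  have direct : ∀ {q r : ℕ} [Fact q.Prime] [Fact r.Prime], q = t → r ∣ Nat.card K →
      HasActingPair K q r := by
    rintro q r _ _ rfl hr
    obtain ⟨g, hg⟩ := exists_prime_orderOf_dvd_card' r hr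
    exact ⟨M, g, .of_forall_pow_eq_one fun a => Subtype.ext (hMt a a.2), hM1, hg,
      fun x hx => hMn.conj_mem x hx g⟩
  by_cases hqt : q = t
  · exact .inl (direct hqt hr)
  by_cases hrt : r = t
  · exact .inr (direct hrt hq)
  have hq' : ¬ q ∣ Nat.card M := fun h => hqt (eq_of_dvd_card_of_exponent M ht Fact.out hMt h)
  have hr' : ¬ r ∣ Nat.card M := fun h => hrt (eq_of_dvd_card_of_exponent M ht Fact.out hMt h)
  have hc := Subgroup.card_eq_card_quotient_mul_card_subgroup M
  have hM2 : 1 < Nat.card M := M.one_lt_card_iff_ne_bot.2 hM1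
  have hpos : 0 < Nat.card (K ⧸ M) := Nat.card_pos
  have hsol : Group.IsSolvable (K ⧸ M) := inferInstance
  refine (ih (Nat.card (K ⧸ M)) ?_ (K ⧸ M) hsol rfl ?_ ?_).imp
    (HasActingPair.of_quotient hqr M hr') (HasActingPair.of_quotient hqr.symm M hq')
  · rw [← hn, hc]; nlinarith
  · exact ((Fact.out : q.Prime).dvd_mul.1 (hc ▸ hq)).resolve_right hq'
  · exact ((Fact.out : r.Prime).dvd_mul.1 (hc ▸ hr)).resolve_right hr'

/-- Three primes, when the group has a normal elementary abelian `p`-subgroup `N` and an acting pair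
for `q` and `r` in the quotient. Since `N` is abelian, the quotient acts on it by conjugation, so no
complement of `N` is needed. -/
theorem exists_orderOf_eq_mul_of_hasActingPair {G : Type*} [Group G] [Finite G] {p q r : ℕ}
    [Fact p.Prime] [Fact q.Prime] [Fact r.Prime] (hpq : p ≠ q) (hpr : p ≠ r) (hqr : q ≠ r)
    (N : Subgroup G) [N.Normal] (hN1 : N ≠ ⊥) (hNc : ∀ a ∈ N, ∀ b ∈ N, a * b = b * a)
    (hNp : ∀ a ∈ N, a ^ p = 1) (h : HasActingPair (G ⧸ N) q r) :
    (∃ g : G, orderOf g = p * q) ∨ (∃ g : G, orderOf g = p * r) ∨ ∃ g : G, orderOf g = q * r := by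
  classical
  by_contra! hcon
  obtain ⟨hcpq, hcpr, hcqr⟩ := hcon
  obtain ⟨Q, g, hQ, hQ1, hg, hn⟩ := h
  let iN : CommGroup N := { (inferInstance : Group N) with
    mul_comm := fun a b => Subtype.ext (hNc a a.2 b b.2) }
  let φ : G ⧸ N →* MulAut N := QuotientGroup.lift N MulAut.conjNormal (by
    intro n hn
    ext x
    simp [MulAut.conjNormal_apply, hNc n hn x x.2])
  have hφ : ∀ (x : G) (v : N), φ x v = v → Commute (v : G) x := by
    intro x v hv
    have h1 := congrArg Subtype.val hv
    change ((MulAut.conjNormal x v : N) : G) = v at h1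
    rw [MulAut.conjNormal_apply, mul_inv_eq_iff_eq_mul] at h1
    exact h1.symm
  have hord : ∀ v : N, v ≠ 1 → orderOf (v : G) = p := fun v hv =>
    orderOf_eq_prime (hNp v v.2) fun h => hv (Subtype.ext h)
  have hQo : ∀ x ∈ Q, x ≠ 1 → q ∣ orderOf x := by
    intro x hx hx1
    rw [← Q.orderOf_mk _ hx]
    exact hQ.dvd_orderOf fun h => hx1 (congrArg Subtype.val h)
  have hRo : ∀ y ∈ Subgroup.zpowers g, y ≠ 1 → orderOf y = r := by
    intro y hy hy1
    obtain ⟨k, rfl⟩ := Subgroup.mem_zpowers_iff.1 hy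
    refine orderOf_eq_prime ?_ hy1
    rw [← zpow_natCast, zpow_comm, zpow_natCast, ← hg, pow_orderOf_eq_one, one_zpow]
  have hfix : ∀ {s : ℕ} [Fact s.Prime], p ≠ s → (∀ g : G, orderOf g ≠ p * s) →
      ∀ S : Subgroup (G ⧸ N), S ≠ ⊥ → (∀ x ∈ S, x ≠ 1 → s ∣ orderOf x) →
      ∀ v : N, (∀ x ∈ S, φ x v = v) → v = 1 := by
    intro s _ hps hcon S hS hSo v hv
    by_contra hv1
    obtain ⟨⟨x, hx⟩, hx1⟩ := Subgroup.ne_bot_iff_exists_ne_one.1 hS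
    obtain ⟨x, rfl⟩ := QuotientGroup.mk'_surjective N x
    obtain ⟨w, hw⟩ := (hφ x v (hv _ hx)).exists_orderOf_eq_mul Fact.out Fact.out hps
      (hord v hv1).symm.dvd ((hSo _ hx fun h => hx1 (Subtype.ext h)).trans
        (orderOf_map_dvd (QuotientGroup.mk' N) x))
    exact hcon w hw
  have hg1 : Subgroup.zpowers g ≠ ⊥ := by
    rw [Ne, Subgroup.zpowers_eq_bot]
    rintro rfl
    rw [orderOf_one] at hg
    exact (Fact.out : r.Prime).one_lt.ne hg
  have hnorm : ∀ y ∈ Subgroup.zpowers g, ∀ x ∈ Q, y * x * y⁻¹ ∈ Q := by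
    intro y hy x hx
    have h1 : g ∈ Subgroup.normalizer (Q : Set (G ⧸ N)) :=
      Subgroup.mem_normalizer_fintype hn
    exact (Subgroup.mem_normalizer_iff.1 ((Subgroup.zpowers_le.2 h1) hy) x).1 hx
  obtain ⟨v, hv⟩ := Subgroup.ne_bot_iff_exists_ne_one.1 hN1
  have key := pow_card_eq_one_of_forall_fixed φ Q (Subgroup.zpowers g) hnorm ?_
    (hfix hpq hcpq Q hQ1 hQo)
    (hfix hpr hcpr _ hg1 fun x hx hx1 => (hRo x hx hx1).symm.dvd) v
  · have h1 : p ∣ Nat.card Q := by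
      rw [← hord v hv, Subgroup.orderOf_coe]
      exact orderOf_dvd_of_pow_eq_one key
    obtain ⟨k, hk⟩ := IsPGroup.iff_card.1 hQ
    rw [hk] at h1
    exact hpq ((Nat.prime_dvd_prime_iff_eq Fact.out Fact.out).1
      ((Fact.out : p.Prime).dvd_of_dvd_pow h1))
  · intro y hy hy1 x hx hc
    by_contra hx1
    obtain ⟨w, hw⟩ := hc.symm.exists_orderOf_eq_mul Fact.out Fact.out hqr (hQo x hx hx1)
      (hRo y hy hy1).symm.dvd
    obtain ⟨w, rfl⟩ := QuotientGroup.mk'_surjective N w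
    obtain ⟨u, hu⟩ := exists_orderOf_eq_of_map (QuotientGroup.mk' N) w
    exact hcqr u (hu.trans hw)

/-- **Lucido's three primes lemma.** Among three distinct prime divisors of the order of a finite
solvable group, two have their product as the order of an element. -/
theorem exists_orderOf_eq_mul_of_three_primes {p q r : ℕ} [Fact p.Prime] [Fact q.Prime]
    [Fact r.Prime] (hpq : p ≠ q) (hpr : p ≠ r) (hqr : q ≠ r) (n : ℕ) :
    ∀ (G : Type*) [Group G] [Finite G], Group.IsSolvable G → Nat.card G = n →
      p ∣ Nat.card G → q ∣ Nat.card G → r ∣ Nat.card G →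
      (∃ g : G, orderOf g = p * q) ∨ (∃ g : G, orderOf g = p * r) ∨
        ∃ g : G, orderOf g = q * r := by
  induction n using Nat.strong_induction_on with
  | _ n ih =>
  intro G _ _ hG hn hp hq hr
  have : Nontrivial G := by
    rw [← Finite.one_lt_card_iff_nontrivial]
    exact (Fact.out : p.Prime).one_lt.trans_le (Nat.le_of_dvd Nat.card_pos hp)
  obtain ⟨t, N, ht, hNn, hN1, hNc, hNt⟩ := exists_normal_exponent_prime G hG
  have hc := Subgroup.card_eq_card_quotient_mul_card_subgroup N
  have hN2 : 1 < Nat.card N := N.one_lt_card_iff_ne_bot.2 hN1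
  have hpos : 0 < Nat.card (G ⧸ N) := Nat.card_pos
  have hsol : Group.IsSolvable (G ⧸ N) := inferInstance
  have hdvd : ∀ {s : ℕ} [Fact s.Prime], s ≠ t → s ∣ Nat.card G → s ∣ Nat.card (G ⧸ N) := by
    intro s _ hst hs
    exact ((Fact.out : s.Prime).dvd_mul.1 (hc ▸ hs)).resolve_right
      fun h => hst (eq_of_dvd_card_of_exponent N ht Fact.out hNt h)
  have hpair : ∀ {a b c : ℕ} [Fact a.Prime] [Fact b.Prime] [Fact c.Prime], a ≠ b → a ≠ c → b ≠ c →
      a = t → b ∣ Nat.card G → c ∣ Nat.card G → (∃ g : G, orderOf g = a * b) ∨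
        (∃ g : G, orderOf g = a * c) ∨ ∃ g : G, orderOf g = b * c := by
    rintro a b c _ _ _ hab hac hbc rfl hb hc
    rcases hasActingPair_or hbc _ (G ⧸ N) hsol rfl (hdvd hab.symm hb) (hdvd hac.symm hc) with h | h
    · exact exists_orderOf_eq_mul_of_hasActingPair hab hac hbc N hN1 hNc hNt h
    · have := exists_orderOf_eq_mul_of_hasActingPair hac hab hbc.symm N hN1 hNc hNt h
      rw [mul_comm c b] at this
      tauto
  by_cases hpt : p = t
  · exact hpair hpq hpr hqr hpt hq hr
  by_cases hqt : q = t
  · have := hpair hpq.symm hqr hpr hqt hp hr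
    rw [mul_comm q p] at this
    tauto
  by_cases hrt : r = t
  · have := hpair hpr.symm hqr.symm hpq hrt hp hq
    rw [mul_comm r p, mul_comm r q] at this
    tauto
  have hlift : ∀ m : ℕ, (∃ g : G ⧸ N, orderOf g = m) → ∃ g : G, orderOf g = m := by
    rintro m ⟨w, hw⟩
    obtain ⟨w, rfl⟩ := QuotientGroup.mk'_surjective N w
    obtain ⟨u, hu⟩ := exists_orderOf_eq_of_map (QuotientGroup.mk' N) w
    exact ⟨u, hu.trans hw⟩
  refine (ih (Nat.card (G ⧸ N)) ?_ (G ⧸ N) hsol rfl (hdvd hpt hp) (hdvd hqt hq)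
    (hdvd hrt hr)).imp (hlift _) (Or.imp (hlift _) (hlift _))
  rw [← hn, hc]; nlinarith

theorem indepSetFree_primeGraph (G : Type*) [Group G] [Finite G] (hG : Group.IsSolvable G) :
    (primeGraph G).IndepSetFree 3 := by
  classical
  rw [← SimpleGraph.cliqueFree_compl]
  intro s hs
  obtain ⟨⟨p, hp, hpG⟩, ⟨q, hq, hqG⟩, ⟨r, hr, hrG⟩, hab, hac, hbc, -⟩ :=
    SimpleGraph.is3Clique_iff.1 hs
  rw [SimpleGraph.compl_adj] at hab hac hbc
  have := Fact.mk hp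
  have := Fact.mk hq
  have := Fact.mk hr
  have hne : ∀ {a b : {p : ℕ // p.Prime ∧ p ∣ Nat.card G}}, a ≠ b → (a : ℕ) ≠ b :=
    fun h h' => h (Subtype.ext h')
  rcases exists_orderOf_eq_mul_of_three_primes (hne hab.1) (hne hac.1) (hne hbc.1) _ G hG rfl
    hpG hqG hrG with h | h | h
  · exact hab.2 ⟨hab.1, h⟩
  · exact hac.2 ⟨hac.1, h⟩
  · exact hbc.2 ⟨hbc.1, h⟩

/-! ### Graphs without triangles and without independent sets of size three -/

namespace SimpleGraph

variable {V W : Type*}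

theorem cliqueFree_three_iff {F : SimpleGraph V} :
    F.CliqueFree 3 ↔ ∀ x y z, F.Adj x y → F.Adj x z → ¬ F.Adj y z := by
  classical
  refine ⟨fun h x y z hxy hxz hyz => h {x, y, z} (is3Clique_triple_iff.2 ⟨hxy, hxz, hyz⟩),
    fun h s hs => ?_⟩
  obtain ⟨x, y, z, hxy, hxz, hyz, -⟩ := is3Clique_iff.1 hs
  exact h x y z hxy hxz hyz

theorem indepSetFree_three_iff {F : SimpleGraph V} :
    F.IndepSetFree 3 ↔ ∀ x y z, x ≠ y → x ≠ z → y ≠ z → F.Adj x y ∨ F.Adj x z ∨ F.Adj y z := by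
  rw [← cliqueFree_compl, cliqueFree_three_iff]
  simp only [compl_adj]
  constructor
  · intro h x y z hxy hxz hyz
    by_contra! hc
    exact h x y z ⟨hxy, hc.1⟩ ⟨hxz, hc.2.1⟩ ⟨hyz, hc.2.2⟩
  · intro h x y z hxy hxz hyz
    rcases h x y z hxy.1 hxz.1 hyz.1 with h | h | h
    exacts [hxy.2 h, hxz.2 h, hyz.2 h]

theorem Iso.cliqueFree_three {F : SimpleGraph V} {H : SimpleGraph W} (e : F ≃g H)
    (h : F.CliqueFree 3) : H.CliqueFree 3 := h.comap e.symm.isContained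

theorem Iso.indepSetFree_three {F : SimpleGraph V} {H : SimpleGraph W} (e : F ≃g H)
    (h : F.IndepSetFree 3) : H.IndepSetFree 3 := by
  rw [indepSetFree_three_iff] at h ⊢
  intro x y z hxy hxz hyz
  simpa only [e.symm.map_adj_iff] using h (e.symm x) (e.symm y) (e.symm z)
    (e.symm.injective.ne hxy) (e.symm.injective.ne hxz) (e.symm.injective.ne hyz)

/-- The upper bound `R(3, 3) ≤ 6`: a vertex has at most two neighbours and at most two
non-neighbours. -/
theorem card_le_five [Fintype V] [Nonempty V] {F : SimpleGraph V} (h1 : F.CliqueFree 3)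
    (h2 : F.IndepSetFree 3) : Fintype.card V ≤ 5 := by
  classical
  rw [cliqueFree_three_iff] at h1
  rw [indepSetFree_three_iff] at h2
  obtain ⟨v⟩ := ‹Nonempty V›
  let A : Finset V := {x | F.Adj v x}
  let B : Finset V := {x | x ≠ v ∧ ¬ F.Adj v x}
  have hA : A.card ≤ 2 := by
    by_contra! hc
    obtain ⟨a, ha, b, hb, c, hc, hab, hac, hbc⟩ := Finset.two_lt_card.1 hc
    simp only [A, Finset.mem_filter_univ] at ha hb hc
    rcases h2 a b c hab hac hbc with h | h | h
    exacts [h1 v a b ha hb h, h1 v a c ha hc h, h1 v b c hb hc h]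
  have hB : B.card ≤ 2 := by
    by_contra! hc
    obtain ⟨a, ha, b, hb, c, hc, hab, hac, hbc⟩ := Finset.two_lt_card.1 hc
    simp only [B, Finset.mem_filter_univ] at ha hb hc
    have key : ∀ x y, x ≠ v ∧ ¬ F.Adj v x → y ≠ v ∧ ¬ F.Adj v y → x ≠ y → F.Adj x y :=
      fun x y hx hy hxy => ((h2 v x y hx.1.symm hy.1.symm hxy).resolve_left hx.2).resolve_left hy.2
    exact h1 a b c (key a b ha hb hab) (key a c ha hc hac) (key b c hb hc hbc)
  have hu : (Finset.univ : Finset V) ⊆ insert v (A ∪ B) := by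
    intro x _
    simp only [A, B, Finset.mem_insert, Finset.mem_union, Finset.mem_filter_univ]
    tauto
  have h3 := Finset.card_le_card hu
  have h4 := Finset.card_insert_le v (A ∪ B)
  have h5 := Finset.card_union_le A B
  rw [Finset.card_univ] at h3
  omega

/-- A relabelling `σ` that turns the adjacency matrix of `F` into the one of `H` is an
isomorphism. -/
theorem nonempty_iso_of_perm {n : ℕ} {F H : SimpleGraph (Fin n)} [DecidableRel F.Adj]
    (T : Fin n → Fin n → Bool) (σ : Equiv.Perm (Fin n))
    (hσ : ∀ x y, decide (F.Adj (σ x) (σ y)) = T x y) (hH : ∀ x y, H.Adj x y ↔ T x y = true) :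
    Nonempty (F ≃g H) :=
  ⟨.symm ⟨σ, fun {x y} => by rw [hH, ← hσ, decide_eq_true_iff]⟩⟩

/-- The adjacency matrix `M` describes a graph without triangles and without independent sets of
size `3`. Symmetry is not asked for; only the entries above the diagonal are read. -/
def IsRamsey {n : ℕ} (M : Fin n → Fin n → Bool) : Prop :=
  ∀ i j k, i < j → j < k → (M i j && M i k && M j k) = false ∧ (M i j || M i k || M j k) = true

instance {n : ℕ} (M : Fin n → Fin n → Bool) : Decidable (IsRamsey M) := by
  unfold IsRamsey; infer_instance

theorem isRamsey_adj {n : ℕ} {F : SimpleGraph (Fin n)} [DecidableRel F.Adj]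
    (h1 : F.CliqueFree 3) (h2 : F.IndepSetFree 3) : IsRamsey fun x y => decide (F.Adj x y) := by
  rw [cliqueFree_three_iff] at h1
  rw [indepSetFree_three_iff] at h2
  intro i j k hij hjk
  have h3 := h1 i j k
  have h4 := h2 i j k hij.ne (hij.trans hjk).ne hjk.ne
  grind

/-- The symmetric `3 × 3` matrix with zero diagonal and the given entries above it, row by row. -/
def mat3 (a b c : Bool) : Fin 3 → Fin 3 → Bool :=
  ![![false, a, b], ![a, false, c], ![b, c, false]]

/-- The symmetric `4 × 4` matrix with zero diagonal and the given entries above it, row by row. -/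
def mat4 (a b c d e f : Bool) : Fin 4 → Fin 4 → Bool :=
  ![![false, a, b, c], ![a, false, d, e], ![b, d, false, f], ![c, e, f, false]]

/-- The symmetric `5 × 5` matrix with zero diagonal and the given entries above it, row by row. -/
def mat5 (a b c d e f g h i j : Bool) : Fin 5 → Fin 5 → Bool :=
  ![![false, a, b, c, d], ![a, false, e, f, g], ![b, e, false, h, i], ![c, f, h, false, j],
    ![d, g, i, j, false]]

theorem mat3_perm : ∀ a b c, IsRamsey (mat3 a b c) → ∃ σ : Equiv.Perm (Fin 3),
    (∀ x y, mat3 a b c (σ x) (σ y) = mat3 true false false x y) ∨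
    (∀ x y, mat3 a b c (σ x) (σ y) = mat3 true false true x y) := by
  decide +kernel

theorem mat4_perm : ∀ a b c d e f, IsRamsey (mat4 a b c d e f) → ∃ σ : Equiv.Perm (Fin 4),
    (∀ x y, mat4 a b c d e f (σ x) (σ y) = mat4 true false false false false true x y) ∨
    (∀ x y, mat4 a b c d e f (σ x) (σ y) = mat4 true false false true false true x y) ∨
    (∀ x y, mat4 a b c d e f (σ x) (σ y) = mat4 true false true true false true x y) := by
  decide +kernel

theorem mat5_perm : ∀ a b c d e f g h i j, IsRamsey (mat5 a b c d e f g h i j) →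
    ∃ σ : Equiv.Perm (Fin 5), ∀ x y, mat5 a b c d e f g h i j (σ x) (σ y) =
      mat5 true false false true true false false true false true x y := by
  decide +kernel

instance (n : ℕ) : DecidableRel (pathGraph n).Adj := fun _ _ => decidable_of_iff' _ pathGraph_adj

instance : (i : Fin 7) → DecidableRel (sevenForests i).2.Adj
  | 0 => inferInstanceAs (DecidableRel (⊥ : SimpleGraph (Fin 1)).Adj)
  | 1 => inferInstanceAs (DecidableRel (⊥ : SimpleGraph (Fin 2)).Adj)
  | 2 => inferInstanceAs (DecidableRel (fromEdgeSet {s((0 : Fin 2), 1)}).Adj)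
  | 3 => inferInstanceAs (DecidableRel (fromEdgeSet {s((0 : Fin 3), 1)}).Adj)
  | 4 => inferInstanceAs (DecidableRel (fromEdgeSet {s((0 : Fin 3), 1), s(1, 2)}).Adj)
  | 5 => inferInstanceAs (DecidableRel (fromEdgeSet {s((0 : Fin 4), 1), s(2, 3)}).Adj)
  | 6 => inferInstanceAs (DecidableRel (fromEdgeSet {s((0 : Fin 4), 1), s(1, 2), s(2, 3)}).Adj)

/-- The graphs without triangles and without independent sets of size `3` are, up to isomorphism,
the seven forests, the `4`-cycle and the `5`-cycle. -/
theorem nonempty_iso_of_cliqueFree_of_indepSetFree [Finite V] [Nonempty V] (F : SimpleGraph V)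
    (h1 : F.CliqueFree 3) (h2 : F.IndepSetFree 3) :
    (∃ i, Nonempty (F ≃g (sevenForests i).2)) ∨ Nonempty (F ≃g cycleGraph 4) ∨
      Nonempty (F ≃g cycleGraph 5) := by
  classical
  have := Fintype.ofFinite V
  have h5 := card_le_five h1 h2
  have h0 : 0 < Fintype.card V := Fintype.card_pos
  obtain ⟨n, hn⟩ : ∃ n, Fintype.card V = n := ⟨_, rfl⟩
  obtain ⟨H, ⟨e⟩⟩ : ∃ H : SimpleGraph (Fin n), Nonempty (F ≃g H) :=
    ⟨_, ⟨Iso.map (Fintype.equivFinOfCardEq hn) F⟩⟩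
  replace h1 := e.cliqueFree_three h1
  replace h2 := e.indepSetFree_three h2
  have hR := isRamsey_adj h1 h2
  rw [hn] at h0 h5
  suffices h : (∃ i, Nonempty (H ≃g (sevenForests i).2)) ∨ Nonempty (H ≃g cycleGraph 4) ∨
      Nonempty (H ≃g cycleGraph 5) from
    h.imp (Exists.imp fun _ => Nonempty.map e.trans)
      (Or.imp (Nonempty.map e.trans) (Nonempty.map e.trans))
  clear e hn
  interval_cases n
  · refine .inl ⟨0, nonempty_iso_of_perm (fun _ _ => false) 1 ?_ ?_⟩
    · intro x y
      simp [Subsingleton.elim x y]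
    · simp [sevenForests]
  · by_cases h : H.Adj 0 1
    · refine .inl ⟨2, nonempty_iso_of_perm (fun x y => x != y) 1 ?_ ?_⟩
      · simp [Fin.forall_fin_two, h, h.symm]
      · simp [Fin.forall_fin_two, sevenForests]
    · refine .inl ⟨1, nonempty_iso_of_perm (fun _ _ => false) 1 ?_ ?_⟩
      · simp [Fin.forall_fin_two, h, H.adj_comm 1 0]
      · simp [sevenForests]
  · have hM : (fun x y => decide (H.Adj x y)) =
        mat3 (decide (H.Adj 0 1)) (decide (H.Adj 0 2)) (decide (H.Adj 1 2)) := by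
      funext x y
      fin_cases x <;> fin_cases y <;> simp [mat3] <;> exact H.adj_comm _ _
    rw [hM] at hR
    obtain ⟨σ, h | h⟩ := mat3_perm _ _ _ hR <;> simp only [← hM] at h
    · exact .inl ⟨3, nonempty_iso_of_perm _ σ h fun x y => by
        fin_cases x <;> fin_cases y <;> simp [sevenForests, mat3]⟩
    · exact .inl ⟨4, nonempty_iso_of_perm _ σ h fun x y => by
        fin_cases x <;> fin_cases y <;> simp [sevenForests, mat3]⟩
  · have hM : (fun x y => decide (H.Adj x y)) =
        mat4 (decide (H.Adj 0 1)) (decide (H.Adj 0 2)) (decide (H.Adj 0 3)) (decide (H.Adj 1 2))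
          (decide (H.Adj 1 3)) (decide (H.Adj 2 3)) := by
      funext x y
      fin_cases x <;> fin_cases y <;> simp [mat4] <;> exact H.adj_comm _ _
    rw [hM] at hR
    obtain ⟨σ, h | h | h⟩ := mat4_perm _ _ _ _ _ _ hR <;> simp only [← hM] at h
    · exact .inl ⟨5, nonempty_iso_of_perm _ σ h fun x y => by
        fin_cases x <;> fin_cases y <;> simp [sevenForests, mat4]⟩
    · exact .inl ⟨6, nonempty_iso_of_perm _ σ h fun x y => by
        fin_cases x <;> fin_cases y <;> simp [sevenForests, mat4]⟩
    · exact .inr (.inl (nonempty_iso_of_perm _ σ h (by decide)))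
  · have hM : (fun x y => decide (H.Adj x y)) =
        mat5 (decide (H.Adj 0 1)) (decide (H.Adj 0 2)) (decide (H.Adj 0 3)) (decide (H.Adj 0 4))
          (decide (H.Adj 1 2)) (decide (H.Adj 1 3)) (decide (H.Adj 1 4)) (decide (H.Adj 2 3))
          (decide (H.Adj 2 4)) (decide (H.Adj 3 4)) := by
      funext x y
      fin_cases x <;> fin_cases y <;> simp [mat5] <;> exact H.adj_comm _ _
    rw [hM] at hR
    obtain ⟨σ, h⟩ := mat5_perm _ _ _ _ _ _ _ _ _ _ hR
    simp only [← hM] at h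
    exact .inr (.inr (nonempty_iso_of_perm _ σ h (by decide)))

theorem isAcyclic_pathGraph_four : (pathGraph 4).IsAcyclic := by
  refine IsTree.isAcyclic (isTree_iff_connected_and_card.2 ⟨pathGraph_connected 3, ?_⟩)
  rw [Nat.card_eq_fintype_card, Nat.card_eq_fintype_card]
  decide

theorem isExceptionalForest_sevenForests (i : Fin 7) : IsExceptionalForest (sevenForests i).2 := by
  refine ⟨?_, ?_, ?_⟩
  · have h : ∀ i, 0 < (sevenForests i).1 := by decide
    exact ⟨⟨0, h i⟩⟩
  · have h : ∀ i, (sevenForests i).1 ≤ 4 := by decide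
    -- each of the seven forests is a subgraph of the path on four vertices, with the same labels
    have hadj : ∀ i x y, (sevenForests i).2.Adj x y →
        (pathGraph 4).Adj (Fin.castLE (h i) x) (Fin.castLE (h i) y) := by
      clear i
      revert h
      decide +kernel
    exact isAcyclic_pathGraph_four.comap ⟨Fin.castLE (h i), hadj i _ _⟩ (Fin.castLE_injective (h i))
  · rw [indepSetFree_three_iff]
    revert i
    decide +kernel

theorem Iso.isExceptionalForest {F : SimpleGraph V} {H : SimpleGraph W} (e : F ≃g H)
    (h : IsExceptionalForest H) : IsExceptionalForest F :=
  ⟨h.1.map e.symm, e.isAcyclic_iff.2 h.2.1, e.symm.indepSetFree_three h.2.2⟩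

theorem IsAcyclic.cliqueFree_three {F : SimpleGraph V} (h : F.IsAcyclic) : F.CliqueFree 3 := by
  classical
  intro s hs
  obtain ⟨_, w, hw, -⟩ := is3Clique_iff_exists_cycle_length_three.1 ⟨s, hs⟩
  exact h w hw

theorem egirth_eq_three_iff {F : SimpleGraph V} : F.egirth = 3 ↔ ¬ F.CliqueFree 3 := by
  classical
  have : ¬ F.CliqueFree 3 ↔ ∃ s, F.IsNClique 3 s := by simp [CliqueFree]
  rw [this, is3Clique_iff_exists_cycle_length_three]
  constructor
  · intro h
    obtain ⟨a, w, hw, hl⟩ := exists_egirth_eq_length.2 fun ha => by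
      rw [ha.egirth_eq_top] at h; exact absurd h (by decide)
    exact ⟨a, w, hw, by rw [h] at hl; exact_mod_cast hl.symm⟩
  · rintro ⟨a, w, hw, hl⟩
    refine le_antisymm ?_ three_le_egirth
    simpa [hl] using egirth_le_length hw

theorem isExceptionalGraph_of_egirth_ne_three [Finite V] [Nonempty V] {F : SimpleGraph V}
    (h : F.egirth ≠ 3) (h2 : F.IndepSetFree 3) : IsExceptionalGraph F := by
  have h1 : F.CliqueFree 3 := by
    by_contra hc
    exact h (egirth_eq_three_iff.2 hc)
  rcases nonempty_iso_of_cliqueFree_of_indepSetFree F h1 h2 with ⟨i, ⟨e⟩⟩ | h | h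
  · exact .inr (.inr (e.isExceptionalForest (isExceptionalForest_sevenForests i)))
  · exact .inl h
  · exact .inr (.inl h)

theorem egirth_ne_three_of_isExceptionalGraph {F : SimpleGraph V} (h : IsExceptionalGraph F) :
    F.egirth ≠ 3 := by
  rw [Ne, egirth_eq_three_iff, not_not]
  rcases h with ⟨⟨e⟩⟩ | ⟨⟨e⟩⟩ | h
  · refine e.symm.cliqueFree_three (cliqueFree_three_iff.2 ?_)
    decide
  · refine e.symm.cliqueFree_three (cliqueFree_three_iff.2 ?_)
    decide
  · exact h.2.1.cliqueFree_three

theorem isExceptionalForest_iff [Finite V] (F : SimpleGraph V) :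
    IsExceptionalForest F ↔ ∃ i, Nonempty (F ≃g (sevenForests i).2) := by
  constructor
  · rintro ⟨hV, hF, h2⟩
    rcases nonempty_iso_of_cliqueFree_of_indepSetFree F hF.cliqueFree_three h2 with
      h | ⟨⟨e⟩⟩ | ⟨⟨e⟩⟩
    · exact h
    · exact absurd (cycleGraph.isCycle_cycle (n := 1)) (e.isAcyclic_iff.1 hF _)
    · exact absurd (cycleGraph.isCycle_cycle (n := 2)) (e.isAcyclic_iff.1 hF _)
  · rintro ⟨i, ⟨e⟩⟩
    exact e.isExceptionalForest (isExceptionalForest_sevenForests i)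

/-- The seven forests differ in the number of vertices or in the number of edges. -/
theorem eq_of_nonempty_iso_sevenForests {i j : Fin 7}
    (h : Nonempty ((sevenForests i).2 ≃g (sevenForests j).2)) : i = j := by
  obtain ⟨e⟩ := h
  have h1 : (sevenForests i).1 = (sevenForests j).1 := by
    simpa using Fintype.card_congr e.toEquiv
  have h2 : Fintype.card {x : Fin (sevenForests i).1 × Fin (sevenForests i).1 //
      (sevenForests i).2.Adj x.1 x.2} = Fintype.card {x : Fin (sevenForests j).1 ×
      Fin (sevenForests j).1 // (sevenForests j).2.Adj x.1 x.2} :=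
    Fintype.card_congr ((e.toEquiv.prodCongr e.toEquiv).subtypeEquiv fun x => e.map_adj_iff.symm)
  clear e
  revert i j
  decide +kernel

end SimpleGraph

/-! ### Groups realising the exceptional graphs -/

theorem orderOf_eq_mul_iff {G : Type*} [Group G] {p q : ℕ} (hp : p.Prime) (hq : q.Prime)
    (hpq : p ≠ q) (x : G) : orderOf x = p * q ↔ x ^ (p * q) = 1 ∧ x ^ p ≠ 1 ∧ x ^ q ≠ 1 := by
  rw [← orderOf_dvd_iff_pow_eq_one, Ne, Ne, ← orderOf_dvd_iff_pow_eq_one,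
    ← orderOf_dvd_iff_pow_eq_one]
  constructor
  · intro h
    rw [h]
    refine ⟨dvd_rfl, fun h' => ?_, fun h' => ?_⟩
    · have := Nat.le_of_dvd hp.pos h'
      nlinarith [hp.pos, hq.two_le]
    · have := Nat.le_of_dvd hq.pos h'
      nlinarith [hq.pos, hp.two_le]
  · rintro ⟨h, hp', hq'⟩
    obtain ⟨a, b, ha, hb, hab⟩ := Nat.dvd_mul.1 h
    rcases (Nat.dvd_prime hp).1 ha with rfl | rfl <;> rcases (Nat.dvd_prime hq).1 hb with rfl | rfl
    · exact absurd (by simp [← hab]) hp'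
    · exact absurd (by simp [← hab]) hq'
    · exact absurd (by simp [← hab]) hp'
    · exact hab.symm

namespace SemidirectProduct

variable {N H : Type*} [CommGroup N] [Group H]

theorem isSolvable {φ : H →* MulAut N} (hH : Group.IsSolvable H) :
    Group.IsSolvable (N ⋊[φ] H) :=
  Group.isSolvable_of_ker_le_range (inl : N →* N ⋊[φ] H) rightHom range_inl_eq_ker_rightHom.ge

instance [Finite N] [Finite H] {φ : H →* MulAut N} : Finite (N ⋊[φ] H) :=
  Finite.of_equiv _ equivProd.symm

/-- Orders of the form `p * q` in a semidirect product of coprime orders: an element of such an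
order can be replaced by a commuting product of an element of `N` and an element of `H`. -/
theorem exists_orderOf_eq_mul_iff {φ : H →* MulAut N} (hcop : (Nat.card N).Coprime (Nat.card H))
    {p q : ℕ} (hp : p.Prime) (hq : q.Prime) (hpq : p ≠ q) :
    (∃ g : N ⋊[φ] H, orderOf g = p * q) ↔
      ∃ (n : N) (h : H), φ h n = n ∧ orderOf (n, h) = p * q := by
  have hnot : ∀ {r : ℕ}, r.Prime → ¬ (r ∣ Nat.card N ∧ r ∣ Nat.card H) := fun hr h =>
    Nat.not_coprime_of_dvd_of_dvd hr.one_lt h.1 h.2 hcop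
  have hinl : ∀ g : N ⋊[φ] H, g.right = 1 → g = inl g.left := fun g hg => by
    ext <;> simp [hg]
  have hpow : ∀ (g : N ⋊[φ] H) (k : ℕ), (g ^ k).right = g.right ^ k := fun g k =>
    map_pow rightHom g k
  have hright : ∀ g : N ⋊[φ] H, orderOf g.right ∣ Nat.card H := fun g => orderOf_dvd_natCard _
  -- for `p ∤ |H|` and `q ∤ |N|`: the power of `g` of order `p` lies in `N`, and the power of order
  -- `q` maps to an element of order `q` of `H`; these two commute, and conjugation by
  -- the left part of the latter is trivial on the abelian group `N`
  have mixed : ∀ {p q : ℕ}, p.Prime → q.Prime → p ≠ q → ¬ p ∣ Nat.card H → ¬ q ∣ Nat.card N →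
      ∀ g : N ⋊[φ] H, orderOf g = p * q →
      ∃ (n : N) (h : H), φ h n = n ∧ orderOf (n, h) = p * q := by
    intro p q hp hq hpq hpH hqN g hg
    have hx : orderOf (g ^ q) = p := by
      rw [orderOf_pow_of_dvd hq.ne_zero (hg ▸ dvd_mul_left q p), hg, Nat.mul_div_cancel _ hq.pos]
    have hy : orderOf (g ^ p) = q := by
      rw [orderOf_pow_of_dvd hp.ne_zero (hg ▸ dvd_mul_right p q), hg,
        Nat.mul_div_cancel_left _ hp.pos]
    have hxr : (g ^ q).right = 1 := by
      have h1 : orderOf (g ^ q).right ∣ p := hx ▸ orderOf_map_dvd rightHom (g ^ q)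
      rcases (Nat.dvd_prime hp).1 h1 with h | h
      · exact orderOf_eq_one_iff.1 h
      · exact absurd (h ▸ hright _) hpH
    have hyr : orderOf (g ^ p).right = q := by
      have h1 : orderOf (g ^ p).right ∣ q := hy ▸ orderOf_map_dvd rightHom (g ^ p)
      refine ((Nat.dvd_prime hq).1 h1).resolve_left fun h => hqN ?_
      rw [← hy, hinl _ (orderOf_eq_one_iff.1 h), orderOf_injective inl inl_injective]
      exact orderOf_dvd_natCard _
    refine ⟨(g ^ q).left, (g ^ p).right, ?_, ?_⟩
    · have hc : g ^ p * g ^ q = g ^ q * g ^ p := by rw [← pow_add, ← pow_add, add_comm]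
      have h2 := congrArg left hc
      rw [mul_left, mul_left, hxr, map_one, MulAut.one_apply, mul_comm] at h2
      exact mul_right_cancel h2
    · rw [Prod.orderOf_mk, hyr, ← orderOf_injective (inl : N →* N ⋊[φ] H) inl_injective,
        ← hinl _ hxr, hx]
      exact Nat.Coprime.lcm_eq_mul ((Nat.coprime_primes hp hq).2 hpq)
  constructor
  · rintro ⟨g, hg⟩
    have hdvd : ∀ {r : ℕ}, r ∣ p * q → r.Prime → ¬ r ∣ Nat.card N → r ∣ Nat.card H := by
      intro r hr hr' h
      have h1 : p * q ∣ Nat.card (N ⋊[φ] H) := hg ▸ orderOf_dvd_natCard g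
      rw [card] at h1
      exact (hr'.dvd_mul.1 (hr.trans h1)).resolve_left h
    have hdp := hdvd (dvd_mul_right p q) hp
    have hdq := hdvd (dvd_mul_left q p) hq
    by_cases hpN : p ∣ Nat.card N <;> by_cases hqN : q ∣ Nat.card N
    · have hg1 : g.right = 1 := by
        have h1 : orderOf g.right ∣ p * q := hg ▸ orderOf_map_dvd rightHom g
        have h2 : (p * q).Coprime (Nat.card H) := by
          refine Nat.Coprime.mul_left ?_ ?_
          · exact (Nat.Prime.coprime_iff_not_dvd hp).2 fun h => hnot hp ⟨hpN, h⟩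
          · exact (Nat.Prime.coprime_iff_not_dvd hq).2 fun h => hnot hq ⟨hqN, h⟩
        exact orderOf_eq_one_iff.1 (Nat.eq_one_of_dvd_coprimes h2 h1 (hright g))
      refine ⟨g.left, 1, by simp, ?_⟩
      rw [Prod.orderOf_mk, orderOf_one, Nat.lcm_one_right,
        ← orderOf_injective (inl : N →* N ⋊[φ] H) inl_injective, ← hinl _ hg1, hg]
    · exact mixed hp hq hpq (fun h => hnot hp ⟨hpN, h⟩) hqN g hg
    · rw [mul_comm]
      exact mixed hq hp hpq.symm (fun h => hnot hq ⟨hqN, h⟩) hpN g (hg.trans (mul_comm _ _))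
    · refine ⟨1, g.right, by simp, ?_⟩
      rw [Prod.orderOf_mk, orderOf_one, Nat.lcm_one_left]
      have h1 : p * q ∣ orderOf g.right * Nat.card N := by
        rw [← hg]
        refine orderOf_dvd_of_pow_eq_one ?_
        rw [pow_mul, hinl (g ^ orderOf g.right) (by rw [hpow, pow_orderOf_eq_one]), ← map_pow,
          pow_card_eq_one', map_one]
      refine Nat.dvd_antisymm (hg ▸ orderOf_map_dvd rightHom g)
        (Nat.Coprime.dvd_of_dvd_mul_right ?_ h1)
      exact Nat.Coprime.mul_left ((Nat.Prime.coprime_iff_not_dvd hp).2 hpN)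
        ((Nat.Prime.coprime_iff_not_dvd hq).2 hqN)
  · rintro ⟨n, h, hn, ho⟩
    refine ⟨inl n * inr h, ?_⟩
    have hc : Commute (inl n : N ⋊[φ] H) (inr h) := by
      have h1 := inl_aut (φ := φ) h n
      rw [hn, map_inv, eq_mul_inv_iff_mul_eq] at h1
      exact h1
    rw [← ho, orderOf_eq_orderOf_iff]
    intro k
    rw [hc.mul_pow, ← map_pow, ← map_pow, ← mk_eq_inl_mul_inr, SemidirectProduct.ext_iff,
      Prod.ext_iff]
    rfl

end SemidirectProduct

/-- Recognition of a prime graph from the factorisation of the group order and a labelling `ps` of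
the vertices by primes. -/
theorem nonempty_iso_primeGraph {k : ℕ} (G : Type*) [Group G] [Finite G] (F : SimpleGraph (Fin k))
    (ps e : Fin k → ℕ) (hp : ∀ i, (ps i).Prime) (hinj : Function.Injective ps)
    (he : ∀ i, e i ≠ 0) (hcard : Nat.card G = ∏ i, ps i ^ e i)
    (hadj : ∀ i j, i < j → (F.Adj i j ↔ ∃ g : G, orderOf g = ps i * ps j)) :
    Nonempty (primeGraph G ≃g F) := by
  have hmem : ∀ i, (ps i).Prime ∧ ps i ∣ Nat.card G := fun i => ⟨hp i, by
    rw [hcard]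
    exact (dvd_pow_self _ (he i)).trans (Finset.dvd_prod_of_mem _ (Finset.mem_univ i))⟩
  let f : Fin k → {p : ℕ // p.Prime ∧ p ∣ Nat.card G} := fun i => ⟨ps i, hmem i⟩
  have hf : Function.Bijective f := by
    refine ⟨fun i j h => hinj (congrArg Subtype.val h), ?_⟩
    rintro ⟨p, hp', hpG⟩
    rw [hcard] at hpG
    obtain ⟨i, -, hi⟩ := (hp'.prime.dvd_finsetProd_iff _).1 hpG
    exact ⟨i, Subtype.ext ((Nat.prime_dvd_prime_iff_eq hp' (hp i)).1 (hp'.dvd_of_dvd_pow hi)).symm⟩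
  have key : ∀ i j, i < j → ((primeGraph G).Adj (f i) (f j) ↔ F.Adj i j) := by
    intro i j hij
    rw [hadj i j hij]
    exact ⟨fun h => h.2, fun h => ⟨hf.1.ne hij.ne, h⟩⟩
  refine ⟨.symm ⟨Equiv.ofBijective f hf, fun {i j} => ?_⟩⟩
  change (primeGraph G).Adj (f i) (f j) ↔ F.Adj i j
  rcases lt_trichotomy i j with h | rfl | h
  · exact key i j h
  · simp
  · rw [SimpleGraph.adj_comm, key j i h, SimpleGraph.adj_comm]

/-- An action of `H` on the additive group `A` by automorphisms, given by a plain function `s` with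
the three laws, as a homomorphism into the automorphisms of `A` written multiplicatively. -/
def addActionHom {H A : Type*} [Group H] [AddCommGroup A] (s : H → A → A) (h1 : ∀ a, s 1 a = a)
    (hmul : ∀ g h a, s (g * h) a = s g (s h a)) (hadd : ∀ g a b, s g (a + b) = s g a + s g b) :
    H →* MulAut (Multiplicative A) where
  toFun g :=
    { toFun := fun a => .ofAdd (s g a.toAdd)
      invFun := fun a => .ofAdd (s g⁻¹ a.toAdd)
      left_inv := fun a => by simp [← hmul, h1]
      right_inv := fun a => by simp [← hmul, h1]
      map_mul' := fun a b => by simp [hadd] }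
  map_one' := by ext a; simp [h1]
  map_mul' g h := by ext a; simp [hmul]

/-- Realisation of a graph by `A ⋊ H` with `A` abelian and coprime orders. By
`SemidirectProduct.exists_orderOf_eq_mul_iff` the labels `p` and `q` are adjacent when some pair
`(a, h)` with `h` fixing `a` has order `p * q` in `A × H`; the last hypothesis spells this out
by powers, in a form that can be decided. -/
theorem exists_group_of_action {k : ℕ} (F : SimpleGraph (Fin k)) {H A : Type} [Group H] [Finite H]
    [AddCommGroup A] [Finite A] (hH : Group.IsSolvable H) (s : H → A → A) (h1 : ∀ a, s 1 a = a)
    (hmul : ∀ g h a, s (g * h) a = s g (s h a)) (hadd : ∀ g a b, s g (a + b) = s g a + s g b)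
    (ps e : Fin k → ℕ) (hp : ∀ i, (ps i).Prime) (hinj : Function.Injective ps)
    (he : ∀ i, e i ≠ 0) (hcard : Nat.card A * Nat.card H = ∏ i, ps i ^ e i)
    (hne : 1 < Nat.card A * Nat.card H) (hcop : (Nat.card A).Coprime (Nat.card H))
    (hadj : ∀ i j, i < j → (F.Adj i j ↔ ∃ (a : A) (h : H), s h a = a ∧
      ((ps i * ps j) • a = 0 ∧ h ^ (ps i * ps j) = 1) ∧ ¬ (ps i • a = 0 ∧ h ^ ps i = 1) ∧
      ¬ (ps j • a = 0 ∧ h ^ ps j = 1))) :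
    ∃ (G : Type) (_ : Group G), Finite G ∧ Nontrivial G ∧ Group.IsSolvable G ∧
      Nonempty (primeGraph G ≃g F) := by
  have hc : Nat.card (Multiplicative A ⋊[addActionHom s h1 hmul hadd] H) =
      Nat.card A * Nat.card H := SemidirectProduct.card
  refine ⟨Multiplicative A ⋊[addActionHom s h1 hmul hadd] H, inferInstance, inferInstance, ?_,
    SemidirectProduct.isSolvable (N := Multiplicative A) hH,
    nonempty_iso_primeGraph _ F ps e hp hinj he (hc.trans hcard) fun i j hij => ?_⟩
  · rw [← Finite.one_lt_card_iff_nontrivial, hc]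
    exact hne
  · have hps : ps i ≠ ps j := hinj.ne hij.ne
    rw [SemidirectProduct.exists_orderOf_eq_mul_iff (N := Multiplicative A) hcop (hp i) (hp j) hps,
      hadj i j hij]
    simp only [orderOf_eq_mul_iff (hp i) (hp j) hps, Ne, Prod.ext_iff]
    rfl

/-- The power `w ^ i` with exponent in `ZMod m`, by way of the representative in `{0, …, m - 1}`. It
is the expected homomorphism when `w ^ m = 1`. -/
def powZMod (n m : ℕ) (w : ZMod n) (i : ZMod m) : ZMod n := w ^ i.val

theorem powZMod_add (n m : ℕ) [NeZero m] (w : ZMod n) (hw : w ^ m = 1) (i j : ZMod m) :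
    powZMod n m w (i + j) = powZMod n m w i * powZMod n m w j := by
  rw [powZMod, powZMod, powZMod, ZMod.val_add, ← pow_eq_pow_mod _ hw, pow_add]

/-- `exists_group_of_action` for `ℤ/m` acting on `ℤ/n` through multiplication by powers of `u`. -/
theorem exists_group_of_cyclic {k : ℕ} (F : SimpleGraph (Fin k)) (n m : ℕ) [NeZero n] [NeZero m]
    (u : ZMod n) (hu : u ^ m = 1)
    (ps e : Fin k → ℕ) (hp : ∀ i, (ps i).Prime) (hinj : Function.Injective ps)
    (he : ∀ i, e i ≠ 0) (hcard : n * m = ∏ i, ps i ^ e i)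
    (hne : 1 < n * m) (hcop : n.Coprime m)
    (hadj : ∀ i j, i < j → (F.Adj i j ↔ ∃ (a : ZMod n) (t : ZMod m), powZMod n m u t * a = a ∧
      (((ps i * ps j : ℕ) : ZMod n) * a = 0 ∧ ((ps i * ps j : ℕ) : ZMod m) * t = 0) ∧
      ¬ ((ps i : ZMod n) * a = 0 ∧ (ps i : ZMod m) * t = 0) ∧
      ¬ ((ps j : ZMod n) * a = 0 ∧ (ps j : ZMod m) * t = 0))) :
    ∃ (G : Type) (_ : Group G), Finite G ∧ Nontrivial G ∧ Group.IsSolvable G ∧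
      Nonempty (primeGraph G ≃g F) := by
  have hn : Nat.card (ZMod n) = n := Nat.card_zmod n
  have hm : Nat.card (Multiplicative (ZMod m)) = m := Nat.card_zmod m
  refine exists_group_of_action F (H := Multiplicative (ZMod m)) (A := ZMod n)
    (Group.isSolvable_of_comm mul_comm)
    (fun t a => powZMod n m u t.toAdd * a) (fun a => ?_) (fun g h a => ?_)
    (fun g a b => mul_add _ _ _)
    ps e hp hinj he ?_ ?_ ?_ fun i j hij => ?_
  · simp [powZMod]
  · rw [toAdd_mul, powZMod_add n m u hu, mul_assoc]
  · rw [hn, hm, hcard]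
  · rwa [hn, hm]
  · rwa [hn, hm]
  · rw [hadj i j hij]
    simp only [nsmul_eq_mul, Multiplicative.exists, ← ofAdd_nsmul, toAdd_ofAdd, ofAdd_eq_one]

/-- The forests are prime graphs of groups `ℤ/n ⋊ ℤ/m`. For `n = 91 = 7 * 13` and `m = 6` the graph
depends on which of the primes `2` and `3` divide the order of the acting unit `u` modulo `7` and
modulo `13`: the unit `10` has order `6` modulo both, and `3` has the orders `6` and `3`. -/
theorem exists_group_sevenForests (i : Fin 7) :
    ∃ (G : Type) (_ : Group G), Finite G ∧ Nontrivial G ∧ Group.IsSolvable G ∧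
      Nonempty (primeGraph G ≃g (sevenForests i).2) := by
  fin_cases i
  · exact exists_group_of_cyclic ⊥ 1 2 1 (by decide) ![2] ![1] (by decide +kernel)
      (by decide) (by decide) (by decide) (by decide) (by decide) (by decide +kernel)
  · exact exists_group_of_cyclic ⊥ 3 2 (-1) (by decide) ![2, 3] ![1, 1] (by decide +kernel)
      (by decide) (by decide) (by decide) (by decide) (by decide) (by decide +kernel)
  · exact exists_group_of_cyclic (.fromEdgeSet {s(0, 1)}) 1 6 1 (by decide) ![2, 3] ![1, 1]
      (by decide +kernel)
      (by decide) (by decide) (by decide) (by decide) (by decide) (by decide +kernel)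
  · exact exists_group_of_cyclic (.fromEdgeSet {s(0, 1)}) 7 6 3 (by decide) ![2, 3, 7] ![1, 1, 1]
      (by decide +kernel)
      (by decide) (by decide) (by decide) (by decide) (by decide) (by decide +kernel)
  · exact exists_group_of_cyclic (.fromEdgeSet {s(0, 1), s(1, 2)}) 15 2 11 (by decide)
      ![2, 5, 3] ![1, 1, 1] (by decide +kernel)
      (by decide) (by decide) (by decide) (by decide) (by decide) (by decide +kernel)
  · exact exists_group_of_cyclic (.fromEdgeSet {s(0, 1), s(2, 3)}) 91 6 10 (by decide)
      ![2, 3, 7, 13] ![1, 1, 1, 1] (by decide +kernel)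
      (by decide) (by decide) (by decide) (by decide) (by decide) (by decide +kernel)
  · exact exists_group_of_cyclic (.fromEdgeSet {s(0, 1), s(1, 2), s(2, 3)}) 91 6 3 (by decide)
      ![7, 13, 2, 3] ![1, 1, 1, 1] (by decide +kernel)
      (by decide) (by decide) (by decide) (by decide) (by decide) (by decide +kernel)

/-- The unit `48` has order `2` modulo `7` and order `3` modulo `13`. -/
theorem exists_group_cycleGraph_four :
    ∃ (G : Type) (_ : Group G), Finite G ∧ Nontrivial G ∧ Group.IsSolvable G ∧
      Nonempty (primeGraph G ≃g SimpleGraph.cycleGraph 4) :=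
  exists_group_of_cyclic (SimpleGraph.cycleGraph 4) 91 6 48 (by decide)
      ![7, 13, 2, 3] ![1, 1, 1, 1] (by decide +kernel)
      (by decide) (by decide) (by decide) (by decide) (by decide) (by decide +kernel)

/-- The action of `D₃ × ℤ/5` on `𝔽₃₁² × 𝔽₁₁`. On `𝔽₃₁²` rotations act by `diag(ω, ω⁻¹)` with
`ω = 5` of order `3`, the reflection `sr 0` interchanges the coordinates, and `ℤ/5` acts by the
scalar `2` of order `5`. On `𝔽₁₁` rotations act trivially, reflections by `-1`, and `ℤ/5` by the scalar `3` of
order `5`. -/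
def dihedralSMul : DihedralGroup 3 × Multiplicative (ZMod 5) → ZMod 31 × ZMod 31 × ZMod 11 →
    ZMod 31 × ZMod 31 × ZMod 11
  | (.r i, k), (x, y, z) => (powZMod 31 3 5 i * (powZMod 31 5 2 k.toAdd * x),
      powZMod 31 3 5 (-i) * (powZMod 31 5 2 k.toAdd * y), powZMod 11 5 3 k.toAdd * z)
  | (.sr i, k), (x, y, z) => (powZMod 31 3 5 (-i) * (powZMod 31 5 2 k.toAdd * y),
      powZMod 31 3 5 i * (powZMod 31 5 2 k.toAdd * x), -(powZMod 11 5 3 k.toAdd * z))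

theorem dihedralSMul_mul (g h : DihedralGroup 3 × Multiplicative (ZMod 5))
    (a : ZMod 31 × ZMod 31 × ZMod 11) :
    dihedralSMul (g * h) a = dihedralSMul g (dihedralSMul h a) := by
  have h5 := powZMod_add 31 3 5 (by decide)
  have h2 := powZMod_add 31 5 2 (by decide)
  have h3 := powZMod_add 11 5 3 (by decide)
  obtain ⟨i | i, k⟩ := g <;> obtain ⟨j | j, l⟩ := h <;> obtain ⟨x, y, z⟩ := a <;>
    simp only [dihedralSMul, Prod.mk_mul_mk, DihedralGroup.r_mul_r, DihedralGroup.r_mul_sr,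
      DihedralGroup.sr_mul_r, DihedralGroup.sr_mul_sr, toAdd_mul, h2, h3, h5, sub_eq_add_neg,
      neg_add, neg_neg] <;>
    refine Prod.ext ?_ (Prod.ext ?_ ?_) <;> dsimp only <;> ring

theorem dihedralSMul_add (g : DihedralGroup 3 × Multiplicative (ZMod 5))
    (a b : ZMod 31 × ZMod 31 × ZMod 11) :
    dihedralSMul g (a + b) = dihedralSMul g a + dihedralSMul g b := by
  obtain ⟨i | i, k⟩ := g <;> obtain ⟨x, y, z⟩ := a <;> obtain ⟨x', y', z'⟩ := b <;>
    simp only [dihedralSMul, Prod.mk_add_mk] <;>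
    refine Prod.ext ?_ (Prod.ext ?_ ?_) <;> dsimp only <;> ring

theorem isSolvable_dihedral_prod :
    Group.IsSolvable (DihedralGroup 3 × Multiplicative (ZMod 5)) := by
  let f : Multiplicative (ZMod 3) × Multiplicative (ZMod 5) →*
      DihedralGroup 3 × Multiplicative (ZMod 5) :=
    { toFun := fun x => (.r x.1.toAdd, x.2), map_one' := rfl, map_mul' := fun _ _ => by simp }
  let g : DihedralGroup 3 × Multiplicative (ZMod 5) →* ℤˣ :=
    { toFun := fun x => match x.1 with | .r _ => 1 | .sr _ => -1
      map_one' := rfl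
      map_mul' := by rintro ⟨_ | _, _⟩ ⟨_ | _, _⟩ <;> simp }
  refine Group.isSolvable_of_ker_le_range f g ?_
  rintro ⟨i | i, k⟩ h
  · exact ⟨(.ofAdd i, k), rfl⟩
  · exact absurd (show (-1 : ℤˣ) = 1 from h) (by decide)

/-- A pair `(a, h)` of order `p * q`, with `p ∤ |H|` and `q ∤ |A|`, has `a` of order `p` and `h` of
order `q`. -/
theorem mixed_order_conditions {H A : Type*} [Group H] [AddCommGroup A] {p q : ℕ}
    (hp : p.Coprime (Nat.card H)) (hq : q.Coprime (Nat.card A)) {a : A} {h : H}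
    (hpq : (p * q) • a = 0 ∧ h ^ (p * q) = 1) (hnp : ¬ (p • a = 0 ∧ h ^ p = 1))
    (hnq : ¬ (q • a = 0 ∧ h ^ q = 1)) : p • a = 0 ∧ a ≠ 0 ∧ h ^ q = 1 ∧ h ≠ 1 := by
  have h1 : h ^ q = 1 := by
    have h2 : orderOf (h ^ q) ∣ p := orderOf_dvd_of_pow_eq_one (by rw [← pow_mul, mul_comm, hpq.2])
    exact orderOf_eq_one_iff.1 (Nat.eq_one_of_dvd_coprimes hp h2 (orderOf_dvd_natCard _))
  have h3 : p • a = 0 := by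
    have h2 : addOrderOf (p • a) ∣ q :=
      addOrderOf_dvd_of_nsmul_eq_zero (by rw [← mul_nsmul, hpq.1])
    exact AddMonoid.addOrderOf_eq_one_iff.1
      (Nat.eq_one_of_dvd_coprimes hq h2 (addOrderOf_dvd_natCard _))
  refine ⟨h3, ?_, h1, ?_⟩
  · rintro rfl
    exact hnq ⟨smul_zero q, h1⟩
  · rintro rfl
    exact hnp ⟨h3, one_pow p⟩

/-- The `5`-cycle `2 - 31 - 11 - 3 - 5 - 2` is the prime graph of `(𝔽₃₁² × 𝔽₁₁) ⋊ (D₃ × ℤ/5)`. In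
a semidirect product of abelian groups of coprime orders, non-adjacent primes divide different
factors, so that the complement of the prime graph is bipartite. The complement of the `5`-cycle is
an odd cycle, and the Frobenius group `D₃` takes the place of an abelian acting group. -/
theorem exists_group_cycleGraph_five :
    ∃ (G : Type) (_ : Group G), Finite G ∧ Nontrivial G ∧ Group.IsSolvable G ∧
      Nonempty (primeGraph G ≃g SimpleGraph.cycleGraph 5) := by
  have hA : Nat.card (ZMod 31 × ZMod 31 × ZMod 11) = 10571 := by simp
  have hH : Nat.card (DihedralGroup 3 × Multiplicative (ZMod 5)) = 30 := by
    rw [Nat.card_prod, DihedralGroup.nat_card]; simp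
  refine exists_group_of_action _ isSolvable_dihedral_prod dihedralSMul ?_ dihedralSMul_mul
    dihedralSMul_add ![2, 31, 11, 3, 5] ![1, 2, 1, 1, 1] (by decide +kernel) (by decide)
    (by decide) ?_ ?_ ?_ ?_
  · rintro ⟨x, y, z⟩
    change dihedralSMul (.r 0, 1) _ = _
    simp [dihedralSMul, powZMod]
  · rw [hA, hH]; rfl
  · rw [hA, hH]; norm_num
  · rw [hA, hH]; norm_num
  have order2 : ∀ h : DihedralGroup 3 × Multiplicative (ZMod 5), h ^ 2 = 1 → h ≠ 1 →
      ∃ i, h = (.sr i, 1) := by decide +kernel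
  have order3 : ∀ h : DihedralGroup 3 × Multiplicative (ZMod 5), h ^ 3 = 1 → h ≠ 1 →
      ∃ i ≠ 0, h = (.r i, 1) := by decide +kernel
  have order5 : ∀ h : DihedralGroup 3 × Multiplicative (ZMod 5), h ^ 5 = 1 → h ≠ 1 →
      ∃ k ≠ 0, h = (.r 0, .ofAdd k) := by decide +kernel
  have order6 : ∀ h : DihedralGroup 3 × Multiplicative (ZMod 5), h ^ 6 = 1 →
      h ^ 2 = 1 ∨ h ^ 3 = 1 := by decide +kernel
  have tors31 : ∀ x : ZMod 31, (11 • x = 0 → x = 0) ∧ (6 • x = 0 → x = 0) := by decide +kernel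
  have tors11 : ∀ x : ZMod 11, (31 • x = 0 → x = 0) ∧ (6 • x = 0 → x = 0) := by decide +kernel
  have fix3 : ∀ i ≠ 0, ∀ x, powZMod 31 3 5 i * x = x → x = 0 := by decide +kernel
  have fix5 : ∀ k ≠ 0, (∀ x, powZMod 31 5 2 k * x = x → x = 0) ∧
      ∀ x, powZMod 11 5 3 k * x = x → x = 0 := by decide +kernel
  have fix2 : ∀ x : ZMod 11, -x = x → x = 0 := by decide +kernel
  have pow0 : ∀ n m w, powZMod n (m + 1) w 0 = 1 := fun n m w => by simp [powZMod]
  -- the pairs of primes at distance two on the cycle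
  have n02 : ∀ a h, dihedralSMul h a = a → ¬ (11 • a = 0 ∧ a ≠ 0 ∧ h ^ 2 = 1 ∧ h ≠ 1) := by
    rintro ⟨x, y, z⟩ h hs ⟨ha, ha0, h2, h1⟩
    obtain ⟨i, rfl⟩ := order2 h h2 h1
    simp only [Prod.smul_mk, Prod.mk_eq_zero] at ha
    simp only [dihedralSMul, toAdd_one, pow0, one_mul, Prod.mk.injEq] at hs
    exact ha0 (by rw [(tors31 x).1 ha.1, (tors31 y).1 ha.2.1, fix2 z hs.2.2]; rfl)
  have n13 : ∀ a h, dihedralSMul h a = a → ¬ (31 • a = 0 ∧ a ≠ 0 ∧ h ^ 3 = 1 ∧ h ≠ 1) := by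
    rintro ⟨x, y, z⟩ h hs ⟨ha, ha0, h3, h1⟩
    obtain ⟨i, hi, rfl⟩ := order3 h h3 h1
    simp only [Prod.smul_mk, Prod.mk_eq_zero] at ha
    simp only [dihedralSMul, toAdd_one, pow0, one_mul, Prod.mk.injEq] at hs
    exact ha0 (by rw [fix3 i hi x hs.1, fix3 (-i) (neg_ne_zero.2 hi) y hs.2.1,
      (tors11 z).1 ha.2.2]; rfl)
  have n5 : ∀ a h, dihedralSMul h a = a → a ≠ 0 → h ^ 5 = 1 → h ≠ 1 → False := by
    rintro ⟨x, y, z⟩ h hs ha0 h5 h1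
    obtain ⟨k, hk, rfl⟩ := order5 h h5 h1
    simp only [dihedralSMul, neg_zero, toAdd_ofAdd, pow0, one_mul, Prod.mk.injEq] at hs
    exact ha0 (by rw [(fix5 k hk).1 x hs.1, (fix5 k hk).1 y hs.2.1, (fix5 k hk).2 z hs.2.2]; rfl)
  intro i j hij
  fin_cases i <;> fin_cases j <;> first | exact absurd hij (by decide) | skip
  · exact iff_of_true (by decide) ⟨(1, 1, 0), (.sr 0, 1), by decide +kernel⟩
  · refine iff_of_false (by decide) ?_
    rintro ⟨a, h, hs, hpq, h2, h11⟩
    exact n02 a h hs (mixed_order_conditions (p := 11) (q := 2) (by rw [hH]; decide)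
      (by rw [hA]; decide) hpq h11 h2)
  · refine iff_of_false (by decide) ?_
    rintro ⟨⟨x, y, z⟩, h, hs, ⟨ha, h6⟩, h2, h3⟩
    have ha0 : (x, y, z) = 0 := by
      change 6 • (x, y, z) = 0 at ha
      simp only [Prod.smul_mk, Prod.mk_eq_zero] at ha
      rw [(tors31 x).2 ha.1, (tors31 y).2 ha.2.1, (tors11 z).2 ha.2.2]
      rfl
    rw [ha0] at h2 h3
    exact (order6 h h6).elim (fun h => h2 ⟨smul_zero _, h⟩) fun h => h3 ⟨smul_zero _, h⟩
  · exact iff_of_true (by decide) ⟨0, (.sr 0, .ofAdd 1), by decide +kernel⟩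
  · exact iff_of_true (by decide) ⟨(1, 1, 1), 1, by decide +kernel⟩
  · refine iff_of_false (by decide) ?_
    rintro ⟨a, h, hs, hpq, h31, h3⟩
    exact n13 a h hs (mixed_order_conditions (p := 31) (q := 3) (by rw [hH]; decide)
      (by rw [hA]; decide) hpq h31 h3)
  · refine iff_of_false (by decide) ?_
    rintro ⟨a, h, hs, hpq, h31, h5⟩
    obtain ⟨-, ha, h5, h1⟩ := mixed_order_conditions (p := 31) (q := 5) (by rw [hH]; decide)
      (by rw [hA]; decide) hpq h31 h5
    exact n5 a h hs ha h5 h1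
  · exact iff_of_true (by decide) ⟨(0, 0, 1), (.r 1, 1), by decide +kernel⟩
  · refine iff_of_false (by decide) ?_
    rintro ⟨a, h, hs, hpq, h11, h5⟩
    obtain ⟨-, ha, h5, h1⟩ := mixed_order_conditions (p := 11) (q := 5) (by rw [hH]; decide)
      (by rw [hA]; decide) hpq h11 h5
    exact n5 a h hs ha h5 h1
  · exact iff_of_true (by decide) ⟨0, (.r 1, .ofAdd 1), by decide +kernel⟩

/-! ### Conclusion -/

theorem exists_group_of_isExceptionalGraph {V : Type*} [Finite V] {F : SimpleGraph V}
    (hF : IsExceptionalGraph F) :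
    ∃ (G : Type) (_ : Group G), Finite G ∧ Nontrivial G ∧ Group.IsSolvable G ∧
      Nonempty (primeGraph G ≃g F) := by
  have transfer : ∀ {k : ℕ} {H : SimpleGraph (Fin k)}, F ≃g H →
      (∃ (G : Type) (_ : Group G), Finite G ∧ Nontrivial G ∧ Group.IsSolvable G ∧
        Nonempty (primeGraph G ≃g H)) →
      ∃ (G : Type) (_ : Group G), Finite G ∧ Nontrivial G ∧ Group.IsSolvable G ∧
        Nonempty (primeGraph G ≃g F) := by
    rintro k H e ⟨G, hG, h1, h2, h3, ⟨e'⟩⟩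
    exact ⟨G, hG, h1, h2, h3, ⟨e'.trans e.symm⟩⟩
  rcases hF with ⟨⟨e⟩⟩ | ⟨⟨e⟩⟩ | h
  · exact transfer e exists_group_cycleGraph_four
  · exact transfer e exists_group_cycleGraph_five
  · obtain ⟨i, ⟨e⟩⟩ := (SimpleGraph.isExceptionalForest_iff F).1 h
    exact transfer e (exists_group_sevenForests i)

theorem nonempty_primeGraph_vertices (G : Type*) [Group G] [Finite G] [Nontrivial G] :
    Nonempty {p : ℕ // p.Prime ∧ p ∣ Nat.card G} := by
  obtain ⟨p, hp, hpG⟩ := Nat.exists_prime_and_dvd (Finite.one_lt_card (α := G)).ne'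
  exact ⟨⟨p, hp, hpG⟩⟩

theorem finite_primeGraph_vertices (G : Type*) [Group G] [Finite G] :
    Finite {p : ℕ // p.Prime ∧ p ∣ Nat.card G} :=
  (Nat.card G).divisors.finite_toSet.subset fun _ hp =>
    Finset.mem_coe.2 (Nat.mem_divisors.2 ⟨hp.2, Nat.card_pos.ne'⟩)

theorem mainTheorem6 :
    -- the girth is three, with the exceptional graphs as the only exceptions
    (∀ (G : Type*) [Group G] [Finite G] [Nontrivial G],
      Group.IsSolvable G →
      ((primeGraph G).egirth ≠ 3 ↔ IsExceptionalGraph (primeGraph G))) ∧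
    -- every exceptional graph is the prime graph of a finite solvable group
    (∀ (V : Type*) [Finite V] (F : SimpleGraph V), IsExceptionalGraph F →
      ∃ (G : Type) (_ : Group G), Finite G ∧ Nontrivial G ∧ Group.IsSolvable G ∧
        Nonempty (primeGraph G ≃g F)) ∧
    -- up to isomorphism, the exceptional forests are exactly the seven listed ones
    (∀ (V : Type*) [Finite V] (F : SimpleGraph V),
      IsExceptionalForest F ↔ ∃ i, Nonempty (F ≃g (sevenForests i).2)) ∧
    (∀ i j, Nonempty ((sevenForests i).2 ≃g (sevenForests j).2) → i = j) := by
  refine ⟨fun G _ _ _ hG => ?_, fun V _ F hF => exists_group_of_isExceptionalGraph hF,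
    fun V _ F => SimpleGraph.isExceptionalForest_iff F,
    fun i j h => SimpleGraph.eq_of_nonempty_iso_sevenForests h⟩
  have := nonempty_primeGraph_vertices G
  have := finite_primeGraph_vertices G
  exact ⟨fun h => SimpleGraph.isExceptionalGraph_of_egirth_ne_three h
    (indepSetFree_primeGraph G hG), SimpleGraph.egirth_ne_three_of_isExceptionalGraph⟩
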